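/- All graphs are finite and simple; $\overline{G}$ is the complement of $G$, and $K_n$ is the complete graph on $n$ vertices ($K_0$ is the empty graph). For graphs $G,H$ write $G\overset{*}{\to}H$ if there exist $d\in\mathbb{N}$ and positive semidefinite matrices $\rho\neq 0$ and $\rho_g^h$ ($g\in V(G)$, $h\in V(H)$) in $M(d,\mathbb{C})$ such that $\sum_{h\in V(H)}\rho_g^h=\rho$ for every $g\in V(G)$, and $\rho_g^h\rho_{g'}^{h'}=0$ whenever $\{g,g'\}\in E(G)$ and $\{h,h'\}\notin E(H)$ (the case $h=h'$ included). The entanglement-assisted cohomomorphism preorder is defined by $G\leq_* H$ if and only if $\overline{G}\overset{*}{\to}\overline{H}$. Let $\mathcal{G}$ be the commutative semiring of isomorphism classes of graphs, with disjoint union $\sqcup$ as addition, strong product $\boxtimes$ as multiplication, zero $K_0$ and unit $K_1$. Let \[ \mathbf{X}(\mathcal{G},\leq_*)=\{\phi\in\mathrm{Hom}(\mathcal{G},\mathbb{R}_{\geq 0}) : \forall G,H\in\mathcal{G},\ G\leq_* H\Rightarrow\phi(G)\leq\phi(H)\} \] be the asymptotic spectrum of graphs with respect to $\leq_*$, where $\mathrm{Hom}$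 denotes semiring homomorphisms. Let $\alpha_*(G)=\max\{n\in\mathbb{N}:\overline{K_n}\leq_* G\}$ be the entanglement-assisted independence number and $\Theta_*(G)=\lim_{N\to\infty}\sqrt[N]{\alpha_*(G^{\boxtimes N})}$ the entanglement-assisted Shannon capacity of $G$. Theorem. Let $G$ be a graph. Then $\alpha_*(G^{\boxtimes N})$ is well defined for every $N$ (the maximum exists), the limit defining $\Theta_*(G)$ exists, and \[ \Theta_*(G)=\min_{\phi\in\mathbf{X}(\mathcal{G},\leq_*)}\phi(G), \] where the minimum is attained. -/

import Mathlib

open Filter Topology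
open scoped NNReal

universe u v w

/-! ### The strong product -/

/-- The strong product `G ⊠ H`. -/
def strongProd {V : Type u} {W : Type v} (G : SimpleGraph V) (H : SimpleGraph W) :
    SimpleGraph (V × W) where
  Adj x y :=
    (x.1 = y.1 ∧ H.Adj x.2 y.2) ∨ (G.Adj x.1 y.1 ∧ H.Adj x.2 y.2) ∨ (G.Adj x.1 y.1 ∧ x.2 = y.2)
  symm := ⟨by
    rintro x y (⟨h, k⟩ | ⟨h, k⟩ | ⟨h, k⟩)
    · exact Or.inl ⟨h.symm, k.symm⟩
    · exact Or.inr (Or.inl ⟨h.symm, k.symm⟩)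
    · exact Or.inr (Or.inr ⟨h.symm, k.symm⟩)⟩
  loopless := ⟨by
    rintro x (⟨_, k⟩ | ⟨h, _⟩ | ⟨h, _⟩)
    · exact H.loopless.irrefl _ k
    · exact G.loopless.irrefl _ h
    · exact G.loopless.irrefl _ h⟩

/-! ### Entanglement-assisted homomorphisms -/

open scoped ComplexOrder in
/-- There is an entanglement-assisted homomorphism from `G` to `H`: for some `d` there are
positive semidefinite complex `d × d` matrices `ρ` and `r g h` (`g ∈ V(G)`, `h ∈ V(H)`), `ρ ≠ 0`
(`ρ` is a quantum state up to normalization), with `∑ h, r g h = ρ` for all `g`, and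
`r g h * r g' h' = 0` whenever `{g, g'} ∈ E(G)` and `{h, h'} ∉ E(H)` (`h = h'` included). -/
def EntHom {V : Type u} {W : Type v} [Fintype W] (G : SimpleGraph V) (H : SimpleGraph W) : Prop :=
  ∃ (d : ℕ) (ρ : Matrix (Fin d) (Fin d) ℂ) (r : V → W → Matrix (Fin d) (Fin d) ℂ),
    ρ.PosSemidef ∧ ρ ≠ 0 ∧ (∀ g h, (r g h).PosSemidef) ∧
    (∀ g, ∑ h, r g h = ρ) ∧
    (∀ g g' h h', G.Adj g g' → ¬ H.Adj h h' → r g h * r g' h' = 0)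

/-- The entanglement-assisted cohomomorphism preorder `G ≤⁎ H` on graphs. -/
def EntCohom {V : Type u} {W : Type v} [Fintype W] (G : SimpleGraph V) (H : SimpleGraph W) : Prop :=
  EntHom Gᶜ Hᶜ

theorem EntCohom.of_iso {V V' : Type u} {W W' : Type v} [Fintype W] [Fintype W']
    {G : SimpleGraph V} {G' : SimpleGraph V'} {H : SimpleGraph W} {H' : SimpleGraph W'}
    (e : G ≃g G') (f : H ≃g H') (h : EntCohom G H) : EntCohom G' H' := by
  obtain ⟨d, ρ, r, h1, h2, h3, h4, h5⟩ := h
  refine ⟨d, ρ, fun g h => r (e.symm g) (f.symm h), h1, h2, fun _ _ => h3 _ _, fun g => ?_, ?_⟩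
  · rw [← h4 (e.symm g)]
    exact Equiv.sum_comp f.symm.toEquiv (fun h => r (e.symm g) h)
  · intro g g' h h' hg hh
    apply h5
    · rw [SimpleGraph.compl_adj] at hg ⊢
      exact ⟨fun q => hg.1 (e.symm.injective q), fun q => hg.2 (e.symm.map_rel_iff.1 q)⟩
    · rw [SimpleGraph.compl_adj] at hh ⊢
      exact fun q => hh ⟨fun t => q.1 (congrArg _ t), fun t => q.2 (f.symm.map_rel_iff.2 t)⟩

/-! ### The semiring of graphs -/

/-- A finite simple graph with its vertex type. -/
structure FinGraph : Type (u + 1) where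
  V : Type u
  [fin : Fintype V]
  graph : SimpleGraph V

attribute [instance] FinGraph.fin

/-- Two finite simple graphs are equivalent when they are isomorphic. -/
instance FinGraph.isoSetoid : Setoid FinGraph.{u} where
  r A B := Nonempty (A.graph ≃g B.graph)
  iseqv :=
    { refl := fun _ => ⟨RelIso.refl _⟩
      symm := fun ⟨e⟩ => ⟨e.symm⟩
      trans := fun ⟨e⟩ ⟨f⟩ => ⟨e.trans f⟩ }

/-- The set of isomorphism classes of finite simple graphs. -/
def GraphClass : Type (u + 1) := Quotient FinGraph.isoSetoid.{u}

namespace GraphClass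

/-- The isomorphism class of a finite simple graph. -/
def mk {V : Type u} [Fintype V] (G : SimpleGraph V) : GraphClass.{u} :=
  Quotient.mk FinGraph.isoSetoid ⟨V, G⟩

theorem mk_eq_mk {V W : Type u} [Fintype V] [Fintype W] {G : SimpleGraph V} {H : SimpleGraph W} :
    mk G = mk H ↔ Nonempty (G ≃g H) :=
  Quotient.eq

theorem ind {p : GraphClass.{u} → Prop}
    (h : ∀ (V : Type u) [Fintype V] (G : SimpleGraph V), p (mk G)) (a : GraphClass.{u}) : p a :=
  Quotient.inductionOn a fun A => h A.V A.graph

/-- The class of the edgeless graph on `n` vertices, the complement of `K_n`. -/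
def edgeless (n : ℕ) : GraphClass.{u} := mk (⊥ : SimpleGraph (ULift.{u} (Fin n)))

/-- The empty graph `K_0`. -/
instance : Zero GraphClass.{u} := ⟨mk (⊥ : SimpleGraph PEmpty.{u + 1})⟩

/-- The one-vertex graph `K_1`. -/
instance : One GraphClass.{u} := ⟨mk (⊥ : SimpleGraph PUnit.{u + 1})⟩

/-- Disjoint union of isomorphism classes. -/
instance : Add GraphClass.{u} :=
  ⟨Quotient.map₂ (fun A B => ⟨A.V ⊕ B.V, A.graph ⊕g B.graph⟩)
    fun _ _ ⟨e⟩ _ _ ⟨f⟩ => ⟨SimpleGraph.Iso.sumCongr e f⟩⟩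

/-- Strong product of isomorphism classes. -/
instance : Mul GraphClass.{u} :=
  ⟨Quotient.map₂ (fun A B => ⟨A.V × B.V, strongProd A.graph B.graph⟩)
    fun A B ⟨e⟩ C D ⟨f⟩ => ⟨⟨e.toEquiv.prodCongr f.toEquiv, by
      rintro ⟨a, b⟩ ⟨a', b'⟩
      have h1 : B.graph.Adj (e a) (e a') ↔ A.graph.Adj a a' := e.map_rel_iff
      have h2 : D.graph.Adj (f b) (f b') ↔ C.graph.Adj b b' := f.map_rel_iff
      simp [strongProd, h1, h2]⟩⟩⟩

theorem mk_add_mk {V W : Type u} [Fintype V] [Fintype W] (G : SimpleGraph V) (H : SimpleGraph W) :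
    mk G + mk H = mk (G ⊕g H) := rfl

theorem mk_mul_mk {V W : Type u} [Fintype V] [Fintype W] (G : SimpleGraph V) (H : SimpleGraph W) :
    mk G * mk H = mk (strongProd G H) := rfl

theorem add_comm' (a b : GraphClass.{u}) : a + b = b + a := by
  induction a using ind with | _ V G
  induction b using ind with | _ W H
  exact mk_eq_mk.2 ⟨SimpleGraph.Iso.sumComm⟩

theorem zero_add' (a : GraphClass.{u}) : 0 + a = a := by
  induction a using ind with | _ V G
  refine mk_eq_mk.2 ⟨⟨Equiv.emptySum _ _, ?_⟩⟩
  rintro (⟨⟨⟩⟩ | a) (⟨⟨⟩⟩ | b)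
  simp

theorem mul_comm' (a b : GraphClass.{u}) : a * b = b * a := by
  induction a using ind with | _ V G
  induction b using ind with | _ W H
  refine mk_eq_mk.2 ⟨⟨Equiv.prodComm _ _, ?_⟩⟩
  rintro ⟨a, b⟩ ⟨a', b'⟩
  simp only [strongProd, Equiv.prodComm_apply, Prod.swap]
  tauto

theorem one_mul' (a : GraphClass.{u}) : 1 * a = a := by
  induction a using ind with | _ V G
  refine mk_eq_mk.2 ⟨⟨Equiv.punitProd _, ?_⟩⟩
  rintro ⟨⟨⟩, b⟩ ⟨⟨⟩, b'⟩
  simp [strongProd]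

theorem zero_mul' (a : GraphClass.{u}) : 0 * a = 0 := by
  induction a using ind with | _ V G
  refine mk_eq_mk.2 ⟨⟨Equiv.equivOfIsEmpty _ _, ?_⟩⟩
  rintro ⟨⟨⟩, b⟩

theorem left_distrib' (a b c : GraphClass.{u}) : a * (b + c) = a * b + a * c := by
  induction a using ind with | _ U G
  induction b using ind with | _ V H
  induction c using ind with | _ W K
  refine mk_eq_mk.2 ⟨⟨Equiv.prodSumDistrib _ _ _, ?_⟩⟩
  rintro ⟨a, (b | b)⟩ ⟨a', (b' | b')⟩ <;> simp [strongProd]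

/-- The commutative semiring of (isomorphism classes of) finite simple graphs, with disjoint union
as addition and strong product as multiplication. -/
instance : CommSemiring GraphClass.{u} where
  add_assoc a b c := by
    induction a using ind with | _ U G
    induction b using ind with | _ V H
    induction c using ind with | _ W K
    exact mk_eq_mk.2 ⟨SimpleGraph.Iso.sumAssoc⟩
  zero_add := zero_add'
  add_zero a := by rw [add_comm', zero_add']
  add_comm := add_comm'
  nsmul := nsmulRec
  left_distrib := left_distrib'
  right_distrib a b c := by rw [mul_comm', left_distrib', mul_comm' c a, mul_comm' c b]
  zero_mul := zero_mul'
  mul_zero a := by rw [mul_comm', zero_mul']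
  mul_assoc a b c := by
    induction a using ind with | _ U G
    induction b using ind with | _ V H
    induction c using ind with | _ W K
    refine mk_eq_mk.2 ⟨⟨Equiv.prodAssoc _ _ _, ?_⟩⟩
    rintro ⟨⟨a, b⟩, c⟩ ⟨⟨a', b'⟩, c'⟩
    simp only [strongProd, Equiv.prodAssoc_apply, Prod.mk.injEq]
    tauto
  one_mul := one_mul'
  mul_one a := by rw [mul_comm', one_mul']
  mul_comm := mul_comm'

/-- The entanglement-assisted cohomomorphism preorder on isomorphism classes of graphs. -/
def EntLE (a b : GraphClass.{u}) : Prop :=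
  Quotient.liftOn₂ a b (fun A B => EntCohom A.graph B.graph)
    fun _ _ _ _ ⟨e⟩ ⟨f⟩ => propext ⟨EntCohom.of_iso e f, EntCohom.of_iso e.symm f.symm⟩

theorem entLE_mk {V W : Type u} [Fintype V] [Fintype W] (G : SimpleGraph V) (H : SimpleGraph W) :
    EntLE (mk G) (mk H) ↔ EntCohom G H := Iff.rfl

/-- The entanglement-assisted independence number `α⁎`, the largest `n` such that the edgeless graph
on `n` vertices is below the graph in the entanglement-assisted cohomomorphism preorder. -/
noncomputable def entIndepNum (a : GraphClass.{u}) : ℕ := sSup {n : ℕ | EntLE (edgeless n) a}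

/-- The entanglement-assisted Shannon capacity
`Θ⁎(G) = lim_{N → ∞} α⁎(G ^ ⊠N) ^ (1 / N)`. -/
noncomputable def entShannonCapacity (a : GraphClass.{u}) : ℝ :=
  limUnder atTop fun N : ℕ => ((entIndepNum (a ^ N) : ℕ) : ℝ) ^ ((1 : ℝ) / (N : ℝ))

end GraphClass

/-- The asymptotic spectrum `X(S, ≤)` of a commutative semiring `S` with respect to a relation `≤`:
the set of monotone semiring homomorphisms from `S` to the nonnegative reals. -/
def asymptoticSpectrum (S : Type w) [CommSemiring S] (le : S → S → Prop) : Set (S →+* ℝ≥0) :=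
  {φ | ∀ a b : S, le a b → φ a ≤ φ b}

/-! ### Strassen preorders -/

/-! This is Strassen duality applied to the entanglement-assisted cohomomorphism preorder.

The bound `Θ⁎(a) ≤ φ a` is direct: a monotone homomorphism fixes natural numbers, so `α⁎(a ^ N) ≤
φ(a) ^ N`. For attainment when `2 ≤ a`, enlarge the preorder by all inequalities `s * a ≤ r` with `s
* Θ⁎(a) < r`. If this created a false inequality between natural numbers, powers of `a` would
dominate natural numbers exceeding what `Θ⁎(a)` allows (`adjoinBound_natCast_le`). By Zorn the
enlarged preorder extends to a maximal one, which is total (`total_of_maximal`); a total Strassen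
preorder compares multiples of an element with natural numbers and so defines a homomorphism to the
nonnegative reals (`rateHom`). It is monotone for the original preorder and is at most `Θ⁎(a)` at
`a`. If `2 ≤ a` fails, then `a ≤ 1` and every spectral point works.

That the graph preorder is Strassen rests on tensoring (`EntHom.trans`) and on a rank count showing
that entanglement does not change the order of natural numbers (`EntHom.card_le_card`). The limit
exists by Fekete's lemma. -/

/-- A Strassen preorder on a commutative semiring in which every element is zero or at least one. -/
structure IsStrassen {S : Type w} [CommSemiring S] (le : S → S → Prop) : Prop where
  refl : ∀ x, le x x
  trans : ∀ {x y z}, le x y → le y z → le x z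
  add_right : ∀ {x y} z, le x y → le (x + z) (y + z)
  mul_right : ∀ {x y} z, le x y → le (x * z) (y * z)
  zero_le : ∀ x, le 0 x
  zero_or_one_le : ∀ x, x = 0 ∨ le 1 x
  exists_natCast_ge : ∀ x, ∃ n : ℕ, le x n
  natCast_le : ∀ {n m : ℕ}, le n m → n ≤ m

namespace IsStrassen

variable {S : Type w} [CommSemiring S] {le : S → S → Prop}

theorem of_le (h : IsStrassen le) {le' : S → S → Prop} (hle : le ≤ le')
    (trans : ∀ {x y z}, le' x y → le' y z → le' x z)
    (add_right : ∀ {x y} z, le' x y → le' (x + z) (y + z))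
    (mul_right : ∀ {x y} z, le' x y → le' (x * z) (y * z))
    (natCast_le : ∀ {n m : ℕ}, le' n m → n ≤ m) : IsStrassen le' where
  refl x := hle _ _ (h.refl x)
  trans := trans
  add_right := add_right
  mul_right := mul_right
  zero_le x := hle _ _ (h.zero_le x)
  zero_or_one_le x := (h.zero_or_one_le x).imp_right (hle _ _)
  exists_natCast_ge x := (h.exists_natCast_ge x).imp fun _ => hle _ _
  natCast_le := natCast_le

theorem add_left (h : IsStrassen le) {x y : S} (z : S) (hxy : le x y) : le (z + x) (z + y) := by
  simpa only [add_comm z] using h.add_right z hxy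

theorem mul_left (h : IsStrassen le) {x y : S} (z : S) (hxy : le x y) : le (z * x) (z * y) := by
  simpa only [mul_comm z] using h.mul_right z hxy

theorem add (h : IsStrassen le) {x y x' y' : S} (h1 : le x y) (h2 : le x' y') :
    le (x + x') (y + y') :=
  h.trans (h.add_right _ h1) (h.add_left _ h2)

theorem mul (h : IsStrassen le) {x y x' y' : S} (h1 : le x y) (h2 : le x' y') :
    le (x * x') (y * y') :=
  h.trans (h.mul_right _ h1) (h.mul_left _ h2)

theorem pow (h : IsStrassen le) {x y : S} (hxy : le x y) (n : ℕ) : le (x ^ n) (y ^ n) := by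
  induction n with
  | zero => simpa using h.refl 1
  | succ n ih => simpa only [pow_succ] using h.mul ih hxy

theorem le_add_right (h : IsStrassen le) (x y : S) : le x (x + y) := by
  simpa using h.add_left x (h.zero_le y)

theorem le_add_left (h : IsStrassen le) (x y : S) : le x (y + x) := by
  simpa using h.add_right x (h.zero_le y)

theorem natCast_mono (h : IsStrassen le) {n m : ℕ} (hnm : n ≤ m) : le (n : S) m := by
  obtain ⟨k, rfl⟩ := Nat.exists_eq_add_of_le hnm
  simpa using h.le_add_right (n : S) k

theorem one_le (h : IsStrassen le) {x : S} (hx : x ≠ 0) : le 1 x :=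
  (h.zero_or_one_le x).resolve_left hx

theorem not_one_le_zero (h : IsStrassen le) : ¬ le 1 0 := fun h' => by
  have : le ((1 : ℕ) : S) ((0 : ℕ) : S) := by simpa using h'
  have := h.natCast_le this
  omega

theorem ne_zero_of_one_le (h : IsStrassen le) {x : S} (hx : le 1 x) : x ≠ 0 := by
  rintro rfl
  exact h.not_one_le_zero hx

theorem mul_ne_zero (h : IsStrassen le) {x y : S} (hx : x ≠ 0) (hy : y ≠ 0) : x * y ≠ 0 :=
  h.ne_zero_of_one_le (by simpa using h.mul (h.one_le hx) (h.one_le hy))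

theorem natCast_ne_zero (h : IsStrassen le) {n : ℕ} (hn : 0 < n) : (n : S) ≠ 0 :=
  h.ne_zero_of_one_le (by simpa using h.natCast_mono (S := S) hn)

/-- The summand `z` survives each exchange of `x` for `y`, so the exchange can be repeated without
cancellation. -/
theorem iterate_add (h : IsStrassen le) {x y z : S} (hxy : le (z + x) (z + y)) (k : ℕ) :
    le (z + k * x) (z + k * y) := by
  induction k with
  | zero => simpa using h.refl z
  | succ k ih =>
    have h1 := h.add_right x ih
    have h2 := h.add_right ((k : S) * y) hxy
    refine h.trans (x := z + (k + 1 : ℕ) * x) (y := z + k * y + x) ?_ ?_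
    · convert h1 using 1
      push_cast
      ring
    · convert h2 using 1
      · ring
      · push_cast
        ring

/-! #### Maximal Strassen preorders -/

/-- The relation generated by `le` and the inequality `c ≤ b`. -/
def adjoin (le : S → S → Prop) (c b : S) (x y : S) : Prop := ∃ t, le (x + t * b) (y + t * c)

theorem le_adjoin (c b : S) : le ≤ adjoin le c b := fun x y hxy => ⟨0, by simpa using hxy⟩

theorem isStrassen_adjoin (h : IsStrassen le) (c b : S)
    (hnat : ∀ {n m : ℕ}, adjoin le c b n m → n ≤ m) : IsStrassen (adjoin le c b) := by
  refine h.of_le (le_adjoin c b) ?_ ?_ ?_ hnat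
  · rintro x y z ⟨t, ht⟩ ⟨t', ht'⟩
    refine ⟨t + t', ?_⟩
    convert h.trans (h.add_right (t' * b) ht) (?_ : le _ (z + t' * c + t * c)) using 1
    · ring
    · ring
    · convert h.add_right (t * c) ht' using 1
      ring
  · rintro x y z ⟨t, ht⟩
    refine ⟨t, ?_⟩
    convert h.add_right z ht using 1 <;> ring
  · rintro x y z ⟨t, ht⟩
    refine ⟨t * z, ?_⟩
    convert h.mul_right z ht using 1 <;> ring

theorem exists_maximal (h : IsStrassen le) :
    ∃ le', le ≤ le' ∧ Maximal IsStrassen le' := by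
  refine zorn_le_nonempty₀ {P : S → S → Prop | IsStrassen P} ?_ le h
  intro c hc hchain P₀ hP₀
  have hle : ∀ P ∈ c, P ≤ fun x y => ∃ P ∈ c, P x y := fun P hP x y hxy => ⟨P, hP, hxy⟩
  refine ⟨fun x y => ∃ P ∈ c, P x y, ?_, hle⟩
  refine (hc hP₀).of_le (hle _ hP₀) ?_ ?_ ?_ ?_
  · rintro x y z ⟨P, hP, hxy⟩ ⟨Q, hQ, hyz⟩
    rcases hchain.total hP hQ with hPQ | hQP
    · exact ⟨Q, hQ, (hc hQ).trans (hPQ _ _ hxy) hyz⟩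
    · exact ⟨P, hP, (hc hP).trans hxy (hQP _ _ hyz)⟩
  · rintro x y z ⟨P, hP, hxy⟩
    exact ⟨P, hP, (hc hP).add_right z hxy⟩
  · rintro x y z ⟨P, hP, hxy⟩
    exact ⟨P, hP, (hc hP).mul_right z hxy⟩
  · rintro n m ⟨P, hP, hxy⟩
    exact (hc hP).natCast_le hxy

theorem le_of_adjoin_natCast_le (h : Maximal IsStrassen le) {c b : S}
    (hnat : ∀ {n m : ℕ}, adjoin le c b n m → n ≤ m) : adjoin le c b ≤ le :=
  h.2 (h.1.isStrassen_adjoin c b hnat) (le_adjoin c b)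

/-- Adjoining the trivial inequality `1 ≤ 1` amounts to adjoining cancellation. It is harmless on
natural numbers: iterating `t + n ≤ t + m` and bounding `t` by a number `k` leaves only a bounded
error. -/
theorem le_of_add_le_add_right (h : Maximal IsStrassen le) {x y z : S}
    (hxy : le (x + z) (y + z)) : le x y := by
  refine le_of_adjoin_natCast_le h (c := 1) (b := 1) ?_ _ _ ⟨z, by simpa using hxy⟩
  rintro n m ⟨t, ht⟩
  simp only [mul_one] at ht
  obtain ⟨k, hk⟩ := h.1.exists_natCast_ge t
  have h1 : le ((((k + 1) * n : ℕ)) : S) ((k + (k + 1) * m : ℕ) : S) := by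
    -- With `k + 1` repetitions the error `k` is too small to make up for `n > m`.
    have h2 := h.1.iterate_add (z := t) (x := n) (y := m) (by simpa only [add_comm t] using ht)
      (k + 1)
    have h3 := h.1.trans (h.1.le_add_left _ t) (h.1.trans h2 (h.1.add_right _ hk))
    simpa using h3
  have h2 := h.1.natCast_le h1
  by_contra hlt
  have h3 : (k + 1) * (m + 1) ≤ (k + 1) * n := Nat.mul_le_mul_left _ (by omega)
  have h4 : (k + 1) * (m + 1) = (k + 1) * m + k + 1 := by ring
  omega

/-- By maximality, adjoining `c ≤ b` must produce a false inequality `n ≤ m` with `m + 1 ≤ n`;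
cancelling `m` leaves the witness. -/
theorem exists_of_not_le (h : Maximal IsStrassen le) {c b : S} (hcb : ¬ le c b) :
    ∃ t, le (1 + t * b) (t * c) := by
  by_contra hne
  refine hcb (le_of_adjoin_natCast_le h (c := c) (b := b) ?_ _ _ ⟨1, ?_⟩)
  · rintro n m ⟨t, ht⟩
    by_contra hlt
    refine hne ⟨t, le_of_add_le_add_right h (z := m) ?_⟩
    have h1 : le ((m + 1 : ℕ) : S) n := h.1.natCast_mono (by omega)
    convert h.1.trans (h.1.add_right (t * b) h1) ht using 1
    · push_cast
      ring
    · ring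
  · rw [one_mul, one_mul, add_comm]
    exact h.1.refl _

theorem total_of_maximal (h : Maximal IsStrassen le) (c b : S) : le c b ∨ le b c := by
  by_contra! hne
  obtain ⟨t, ht⟩ := exists_of_not_le h hne.1
  obtain ⟨t', ht'⟩ := exists_of_not_le h hne.2
  -- Weighting the two witnesses by `t'` and `t` puts `t * t' * (b + c)` on both sides, where it
  -- cancels.
  have h1 := h.1.add (h.1.mul_right t' ht) (h.1.mul_right t ht')
  have h2 : le (t + t') 0 := by
    refine le_of_add_le_add_right h (z := t * t' * (b + c)) ?_
    convert h1 using 1 <;> ring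
  have h3 : t ≠ 0 := by
    rintro rfl
    simp only [zero_mul, add_zero] at ht
    exact h.1.not_one_le_zero ht
  exact h.1.not_one_le_zero (h.1.trans (h.1.one_le h3) (h.1.trans (h.1.le_add_right _ _) h2))

/-! #### The real-valued homomorphism of a total Strassen preorder -/

/-- The infimum of the fractions `r / s` with `s * x ≤ r`. -/
noncomputable def rate (le : S → S → Prop) (x : S) : ℝ :=
  sInf {q : ℝ | ∃ r s : ℕ, 0 < s ∧ le (s * x) r ∧ q = r / s}

theorem rate_bddBelow (x : S) :
    BddBelow {q : ℝ | ∃ r s : ℕ, 0 < s ∧ le (s * x) r ∧ q = r / s} := by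
  refine ⟨0, ?_⟩
  rintro q ⟨r, s, -, -, rfl⟩
  positivity

theorem rate_nonneg (x : S) : 0 ≤ rate le x := by
  apply Real.sInf_nonneg
  rintro q ⟨r, s, -, -, rfl⟩
  positivity

theorem mul_rate_le {x : S} {r s : ℕ} (hs : 0 < s) (hx : le (s * x) r) : s * rate le x ≤ r := by
  have h1 : rate le x ≤ r / s := csInf_le (rate_bddBelow x) ⟨r, s, hs, hx, rfl⟩
  rwa [le_div_iff₀' (by exact_mod_cast hs)] at h1

theorem le_mul_rate (h : IsStrassen le) {x : S} {r s : ℕ} (hs : 0 < s) (hx : le r (s * x)) :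
    (r : ℝ) ≤ s * rate le x := by
  rw [← div_le_iff₀' (by exact_mod_cast hs)]
  apply le_csInf
  · obtain ⟨n, hn⟩ := h.exists_natCast_ge x
    exact ⟨_, n, 1, one_pos, by simpa using hn, rfl⟩
  · rintro q ⟨r', s', hs', hx', rfl⟩
    rw [div_le_div_iff₀ (by exact_mod_cast hs) (by exact_mod_cast hs')]
    have h1 : le ((r * s' : ℕ) : S) ((r' * s : ℕ) : S) := by
      push_cast
      refine h.trans (h.mul_right _ hx) ?_
      convert h.mul_right (s : S) hx' using 1
      ring
    exact_mod_cast h.natCast_le h1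

/-- Take the least natural number above `y`: its predecessor is not above `y`, hence below it by
totality. -/
theorem exists_nat_approx (h : IsStrassen le) (htot : ∀ x y, le x y ∨ le y x) (y : S) :
    ∃ r : ℕ, le r y ∧ le y (r + 1 : ℕ) := by
  classical
  have hex := h.exists_natCast_ge y
  rcases hk : Nat.find hex with _ | k
  · have h1 := Nat.find_spec hex
    rw [hk] at h1
    exact ⟨0, by simpa using h.zero_le y, h.trans h1 (h.natCast_mono (Nat.zero_le _))⟩
  · have h1 := Nat.find_spec hex
    rw [hk] at h1
    exact ⟨k, (htot _ _).resolve_left (Nat.find_min hex (m := k) (by omega)), h1⟩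

theorem eq_zero_of_forall_nat_mul_abs_le {d C : ℝ} (h : ∀ s : ℕ, 0 < s → s * |d| ≤ C) : d = 0 := by
  by_contra hd
  obtain ⟨s, hs⟩ := exists_nat_gt (C / |d|)
  have hd' : 0 < |d| := abs_pos.2 hd
  rw [div_lt_iff₀ hd'] at hs
  have h1 := h (s + 1) (Nat.succ_pos _)
  push_cast at h1
  linarith

theorem rate_add (h : IsStrassen le) (htot : ∀ x y, le x y ∨ le y x) (x y : S) :
    rate le (x + y) = rate le x + rate le y := by
  rw [← sub_eq_zero]
  -- Scaled by `s`, both sides lie in `[r + r', r + r' + 2]`.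
  refine eq_zero_of_forall_nat_mul_abs_le (C := 2) fun s hs => ?_
  obtain ⟨r, h1, h2⟩ := h.exists_nat_approx htot (s * x)
  obtain ⟨r', h1', h2'⟩ := h.exists_nat_approx htot (s * y)
  have a1 := h.le_mul_rate hs h1
  have a2 := mul_rate_le hs h2
  have b1 := h.le_mul_rate hs h1'
  have b2 := mul_rate_le hs h2'
  have c1 := h.le_mul_rate (x := x + y) (r := r + r') hs (by
    push_cast
    rw [mul_add]
    exact h.add h1 h1')
  have c2 := mul_rate_le (le := le) (x := x + y) (r := (r + 1) + (r' + 1)) hs (by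
    rw [mul_add, Nat.cast_add (r + 1)]
    exact h.add h2 h2')
  have hs' : (0 : ℝ) ≤ s := s.cast_nonneg
  rw [← abs_of_nonneg hs', ← abs_mul, abs_le]
  push_cast at *
  constructor <;> linarith

theorem rate_mul (h : IsStrassen le) (htot : ∀ x y, le x y ∨ le y x) (x y : S) :
    rate le (x * y) = rate le x * rate le y := by
  rw [← sub_eq_zero]
  -- Scaled by `s * s`, both sides lie between `r * r'` and `(r + 1) * (r' + 1)`. The gap `r + r' +
  -- 1` is at most `s` times this constant.
  refine eq_zero_of_forall_nat_mul_abs_le (C := rate le x + rate le y + 1) fun s hs => ?_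
  obtain ⟨r, h1, h2⟩ := h.exists_nat_approx htot (s * x)
  obtain ⟨r', h1', h2'⟩ := h.exists_nat_approx htot (s * y)
  have a1 := h.le_mul_rate hs h1
  have a2 := mul_rate_le hs h2
  have b1 := h.le_mul_rate hs h1'
  have b2 := mul_rate_le hs h2'
  have c1 := h.le_mul_rate (x := x * y) (r := r * r') (s := s * s) (by positivity) (by
    convert h.mul h1 h1' using 1
    · push_cast
      ring
    · push_cast
      ring)
  have c2 := mul_rate_le (le := le) (x := x * y) (r := (r + 1) * (r' + 1)) (s := s * s)
    (by positivity) (by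
      convert h.mul h2 h2' using 1
      · push_cast
        ring
      · push_cast
        ring)
  have hs' : (1 : ℝ) ≤ s := by exact_mod_cast hs
  have hx := rate_nonneg (le := le) x
  have hy := rate_nonneg (le := le) y
  push_cast at *
  have d1 : (r : ℝ) * r' ≤ (s * rate le x) * (s * rate le y) :=
    mul_le_mul a1 b1 (by positivity) (by positivity)
  have d2 : (s * rate le x) * (s * rate le y) ≤ ((r : ℝ) + 1) * (r' + 1) :=
    mul_le_mul a2 b2 (by positivity) (by positivity)
  have key : (s : ℝ) * (s * |rate le (x * y) - rate le x * rate le y|)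
      ≤ s * (rate le x + rate le y + 1) := by
    rw [← mul_assoc, ← abs_of_nonneg (by positivity : (0 : ℝ) ≤ s * s), ← abs_mul, abs_le]
    constructor <;> nlinarith
  exact le_of_mul_le_mul_left key (by linarith)

theorem rate_zero (h : IsStrassen le) : rate le (0 : S) = 0 := by
  refine le_antisymm ?_ (rate_nonneg _)
  simpa using mul_rate_le (le := le) (x := 0) (r := 0) one_pos (by simpa using h.refl 0)

theorem rate_one (h : IsStrassen le) : rate le (1 : S) = 1 := by
  refine le_antisymm ?_ ?_
  · simpa using mul_rate_le (le := le) (x := 1) (r := 1) one_pos (by simpa using h.refl 1)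
  · simpa using h.le_mul_rate (x := 1) (r := 1) one_pos (by simpa using h.refl 1)

theorem rate_mono (h : IsStrassen le) (htot : ∀ x y, le x y ∨ le y x) {x y : S} (hxy : le x y) :
    rate le x ≤ rate le y := by
  rw [← sub_nonneg]
  by_contra! hneg
  refine hneg.ne (eq_zero_of_forall_nat_mul_abs_le (C := 1) fun s hs => ?_)
  obtain ⟨r, h1, h2⟩ := h.exists_nat_approx htot (s * y)
  have a1 := h.le_mul_rate hs h1
  have b2 := mul_rate_le hs (h.trans (h.mul_left s hxy) h2)
  rw [abs_of_neg hneg]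
  push_cast at *
  linarith

/-- The homomorphism to the nonnegative reals given by a total Strassen preorder. -/
noncomputable def rateHom (h : IsStrassen le) (htot : ∀ x y, le x y ∨ le y x) : S →+* ℝ≥0 where
  toFun x := ⟨rate le x, rate_nonneg x⟩
  map_zero' := Subtype.ext h.rate_zero
  map_one' := Subtype.ext h.rate_one
  map_add' x y := Subtype.ext (h.rate_add htot x y)
  map_mul' x y := Subtype.ext (h.rate_mul htot x y)

theorem exists_mem_asymptoticSpectrum (h : IsStrassen le) :
    ∃ φ ∈ asymptoticSpectrum S le, ∀ (x : S) (r s : ℕ), 0 < s → le (s * x) r →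
      s * (φ x : ℝ) ≤ r := by
  obtain ⟨le', hle, hmax⟩ := h.exists_maximal
  refine ⟨hmax.1.rateHom (total_of_maximal hmax), fun a b hab => ?_, fun x r s hs hxr => ?_⟩
  · exact hmax.1.rate_mono (total_of_maximal hmax) (hle _ _ hab)
  · exact mul_rate_le hs (hle _ _ hxr)

/-! #### Duality for the asymptotic subrank -/

theorem mul_pow_le (h : IsStrassen le) {T x y : S} (hxy : le (T * x) (T * y)) (n : ℕ) :
    le (T * x ^ n) (T * y ^ n) := by
  induction n with
  | zero => simpa using h.refl T
  | succ n ih =>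
    refine h.trans (y := T * x ^ n * y) ?_ ?_
    · convert h.mul_right (x ^ n) hxy using 1 <;> ring
    · convert h.mul_right y ih using 1
      ring

theorem le_of_forall_pow_le_mul_pow {x y C : ℝ} (hy : 0 < y)
    (h : ∀ n : ℕ, x ^ n ≤ C * y ^ n) : x ≤ y := by
  by_contra! hlt
  obtain ⟨n, hn⟩ := pow_unbounded_of_one_lt C ((one_lt_div hy).2 hlt)
  rw [div_pow, lt_div_iff₀ (by positivity)] at hn
  exact absurd (h n) (not_le.2 hn)

/-- The catalyst `T` is kept through `L` repetitions and removed once, using `1 ≤ T ≤ K ≤ a ^ K`. It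
costs a factor `Θ ^ K` independent of `L`, which disappears in the `L`-th root. -/
theorem natCast_le_pow_of_mul_le (h : IsStrassen le) {a : S} (ha : le 2 a) {Θ : ℝ}
    (hΘ : ∀ n N : ℕ, le n (a ^ N) → (n : ℝ) ≤ Θ ^ N) {T : S} (hT : T ≠ 0) {n m : ℕ}
    (hle : le (T * n) (T * a ^ m)) : (n : ℝ) ≤ Θ ^ m := by
  have h2 : (2 : ℝ) ≤ Θ := by simpa using hΘ 2 1 (by simpa using ha)
  obtain ⟨K, hK⟩ := h.exists_natCast_ge T
  refine le_of_forall_pow_le_mul_pow (C := Θ ^ K) (by positivity) fun L => ?_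
  have h3 : le ((n ^ L : ℕ) : S) (a ^ (K + m * L)) := by
    have h4 := h.mul_right ((n : S) ^ L) (h.one_le hT)
    have h5 := h.trans h4 (h.trans (h.mul_pow_le hle L) (h.mul_right _ hK))
    have h6 : le (K : S) (a ^ K) := by
      refine h.trans (h.natCast_mono (Nat.lt_two_pow_self (n := K)).le) ?_
      simpa using h.pow ha K
    convert h.trans h5 (h.mul_right _ h6) using 1
    · simp
    · rw [pow_add, pow_mul]
  have h7 := hΘ _ _ h3
  rw [pow_add, pow_mul] at h7
  exact_mod_cast h7

/-- In the `M`-th power the factor `q ^ M` is absorbed into the catalyst, leaving the floor of `(p /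
q) ^ M` against `a ^ M`. Rounding costs less than one, and Bernoulli's inequality rules out `p / q >
Θ` for large `M`. -/
theorem natCast_le_mul_of_mul_le (h : IsStrassen le) {a : S} (ha : le 2 a) {Θ : ℝ}
    (hΘ : ∀ n N : ℕ, le n (a ^ N) → (n : ℝ) ≤ Θ ^ N) {T : S} (hT : T ≠ 0) {p q : ℕ} (hq : 0 < q)
    (hle : le (T * p) (T * (q * a))) : (p : ℝ) ≤ q * Θ := by
  have h2 : (2 : ℝ) ≤ Θ := by simpa using hΘ 2 1 (by simpa using ha)
  have hq' : (0 : ℝ) < q := by exact_mod_cast hq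
  have key : ∀ M : ℕ, ((p : ℝ) / q) ^ M < Θ ^ M + 1 := by
    intro M
    have h3 : le (T * q ^ M * (p ^ M / q ^ M : ℕ)) (T * q ^ M * a ^ M) := by
      have h4 := h.mul_pow_le hle M
      rw [mul_pow, ← mul_assoc] at h4
      refine h.trans ?_ h4
      rw [mul_assoc]
      apply h.mul_left
      exact_mod_cast h.natCast_mono (S := S) (Nat.mul_div_le (p ^ M) (q ^ M))
    have hT' : T * (q : S) ^ M ≠ 0 := by
      refine h.mul_ne_zero hT ?_
      exact_mod_cast h.natCast_ne_zero (S := S) (pow_pos hq M)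
    have h5 := h.natCast_le_pow_of_mul_le ha hΘ hT' h3
    have h6 := Nat.lt_div_mul_add (a := p ^ M) (pow_pos hq M)
    have h7 : (p : ℝ) ^ M < (p ^ M / q ^ M : ℕ) * (q : ℝ) ^ M + (q : ℝ) ^ M := by exact_mod_cast h6
    rw [div_pow, div_lt_iff₀ (by positivity)]
    refine h7.trans_le ?_
    have h8 : (0 : ℝ) < (q : ℝ) ^ M := by positivity
    nlinarith
  by_contra! hlt
  have hc : Θ < p / q := by rwa [lt_div_iff₀' hq']
  obtain ⟨M, hM⟩ := exists_nat_gt (1 / (p / q - Θ))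
  rw [div_lt_iff₀ (by linarith)] at hM
  have hb := one_add_mul_le_pow (a := (p / q) / Θ - 1) (by
    have : 0 ≤ (p : ℝ) / q / Θ := by positivity
    linarith) M
  have hM' := key M
  have h9 : (p : ℝ) / q = Θ * (1 + ((p / q) / Θ - 1)) := by
    field_simp
    ring
  rw [h9, mul_pow] at hM'
  have h10 : (1 : ℝ) ≤ Θ ^ M := one_le_pow₀ (by linarith)
  have hM0 : M ≠ 0 := by
    rintro rfl
    norm_num at hM
  have h11 : Θ ≤ Θ ^ M := le_self_pow₀ (by linarith) hM0
  have h12 : Θ ^ M * (1 + M * ((p / q) / Θ - 1)) ≤ Θ ^ M * (1 + ((p / q) / Θ - 1)) ^ M :=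
    mul_le_mul_of_nonneg_left hb (by linarith)
  have h13 : (M : ℝ) * (p / q - Θ) ≤ Θ ^ M * (M * ((p / q) / Θ - 1)) := by
    have h14 : (M : ℝ) * (p / q - Θ) = Θ * (M * ((p / q) / Θ - 1)) := by
      field_simp
    rw [h14]
    apply mul_le_mul_of_nonneg_right h11
    have : 1 ≤ (p : ℝ) / q / Θ := by
      rw [le_div_iff₀ (by linarith)]
      linarith
    exact mul_nonneg (Nat.cast_nonneg _) (by linarith)
  nlinarith

/-- The relation generated by `le`, division by positive integers and the inequalities `s * a ≤ r`
with `s * Θ < r`. -/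
def adjoinBound (le : S → S → Prop) (a : S) (Θ : ℝ) (x y : S) : Prop :=
  ∃ (m r s : ℕ) (t : S), 0 < m ∧ 0 < s ∧ s * Θ < r ∧ le (m * x + t * r) (m * y + t * (s * a))

theorem adjoinBound_trans (h : IsStrassen le) {a : S} {Θ : ℝ} {x y z : S}
    (hxy : adjoinBound le a Θ x y) (hyz : adjoinBound le a Θ y z) : adjoinBound le a Θ x z := by
  obtain ⟨m, r, s, t, hm, hs, hr, h1⟩ := hxy
  obtain ⟨m', r', s', t', hm', hs', hr', h2⟩ := hyz
  have h3 : le (m * m' * x + m' * t * r + m * t' * r')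
      (m * m' * z + (m' * t * s + m * t' * s') * a) := by
    refine h.trans (y := m * m' * y + m' * t * s * a + m * t' * r') ?_ ?_
    · convert h.add_right (m * t' * r') (h.mul_left (m' : S) h1) using 1 <;> ring
    · convert h.add_right (m' * t * s * a) (h.mul_left (m : S) h2) using 1 <;> ring
  -- The smaller of the bounds `r / s`, `r' / s'` on `a` is the stronger one and replaces the other.
  -- Clearing its denominator enlarges the multiplier of `x` and `z`, hence the division built into
  -- `adjoinBound`.
  rcases le_total (s' * r) (s * r') with hle | hle
  · refine ⟨s * (m * m'), r, s, s * m' * t + s' * m * t', by positivity, hs, hr, ?_⟩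
    have h4 := h.mul_left (m * t') (h.natCast_mono (S := S) hle)
    have h5 := h.add_left (s * (m * m' * x + m' * t * r)) h4
    convert h.trans h5 (?_ : le _ (s * (m * m' * z + (m' * t * s + m * t' * s') * a))) using 1
    · push_cast
      ring
    · push_cast
      ring
    · convert h.mul_left (s : S) h3 using 1
      push_cast
      ring
  · refine ⟨s' * (m * m'), r', s', s * m' * t + s' * m * t', by positivity, hs', hr', ?_⟩
    have h4 := h.mul_left (m' * t) (h.natCast_mono (S := S) hle)
    have h5 := h.add_left (s' * (m * m' * x + m * t' * r')) h4
    convert h.trans h5 (?_ : le _ (s' * (m * m' * z + (m' * t * s + m * t' * s') * a))) using 1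
    · push_cast
      ring
    · push_cast
      ring
    · convert h.mul_left (s' : S) h3 using 1
      push_cast
      ring

/-- From `n > k` one gets `z + t * r ≤ z + t * (s * a)` with `t ≠ 0`. Iterating and absorbing the
leftover `z` into one extra `a` gives `j * r ≤ (j * s + 1) * Θ` for all `j`, contradicting `s * Θ <
r`. -/
theorem adjoinBound_natCast_le (h : IsStrassen le) {a : S} (ha : le 2 a) {Θ : ℝ}
    (hΘ : ∀ n N : ℕ, le n (a ^ N) → (n : ℝ) ≤ Θ ^ N) {n k : ℕ}
    (hnk : adjoinBound le a Θ n k) : n ≤ k := by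
  obtain ⟨m, r, s, t, hm, hs, hr, h1⟩ := hnk
  have h2 : (2 : ℝ) ≤ Θ := by simpa using hΘ 2 1 (by simpa using ha)
  by_contra! hlt
  have ha1 : le 1 a := h.trans (by
    have : le ((1 : ℕ) : S) ((2 : ℕ) : S) := h.natCast_mono (by norm_num)
    simpa using this) ha
  have ht : t ≠ 0 := by
    rintro rfl
    have : le ((m * n : ℕ) : S) ((m * k : ℕ) : S) := by simpa using h1
    exact absurd (h.natCast_le this) (not_le.2 (Nat.mul_lt_mul_of_pos_left hlt hm))
  have h3 : le ((m * k + 1 : ℕ) + t * r) ((m * k + 1 : ℕ) + t * (s * a)) := by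
    have h4 : le ((m * k : ℕ) : S) ((m * n : ℕ) : S) :=
      h.natCast_mono (Nat.mul_le_mul_left _ hlt.le)
    have h5 := h.add_left 1 (h.trans (h.add_right (t * r) h4) (by simpa using h1))
    convert h5 using 1 <;> push_cast <;> ring
  -- The extra `1` makes `z` nonzero, so that `z * t` can serve as the catalyst.
  set z : ℕ := m * k + 1
  have h4 : ∀ j : ℕ, ((j * r : ℕ) : ℝ) ≤ (j * s + 1 : ℕ) * Θ := by
    intro j
    have hT : (z : S) * t ≠ 0 := h.mul_ne_zero (h.natCast_ne_zero (Nat.succ_pos _)) ht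
    refine h.natCast_le_mul_of_mul_le ha hΘ hT (Nat.succ_pos _) ?_
    have h5 := h.trans (h.le_add_left _ _) (h.iterate_add h3 (z * j))
    refine h.trans (y := z + (z * j : ℕ) * (t * (s * a))) ?_ ?_
    · convert h5 using 1
      push_cast
      ring
    · have h6 : le (z : S) (z * t * a) := by
        have h7 := h.mul_left (z : S) (h.mul (h.one_le ht) ha1)
        convert h7 using 1 <;> ring
      convert h.add_right ((z * j : ℕ) * (t * (s * a))) h6 using 1
      push_cast
      ring
  obtain ⟨j, hj⟩ := exists_nat_gt (Θ / (r - s * Θ))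
  rw [div_lt_iff₀ (by linarith)] at hj
  have h5 := h4 j
  push_cast at h5
  linarith

theorem isStrassen_adjoinBound (h : IsStrassen le) {a : S} (ha : le 2 a) {Θ : ℝ}
    (hΘ : ∀ n N : ℕ, le n (a ^ N) → (n : ℝ) ≤ Θ ^ N) : IsStrassen (adjoinBound le a Θ) := by
  obtain ⟨r₀, hr₀⟩ := exists_nat_gt Θ
  refine h.of_le ?_ h.adjoinBound_trans ?_ ?_ (h.adjoinBound_natCast_le ha hΘ)
  · exact fun x y hxy => ⟨1, r₀, 1, 0, one_pos, one_pos, by simpa using hr₀, by simpa using hxy⟩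
  · rintro x y z ⟨m, r, s, t, hm, hs, hr, h1⟩
    refine ⟨m, r, s, t, hm, hs, hr, ?_⟩
    convert h.add_right (m * z) h1 using 1 <;> ring
  · rintro x y z ⟨m, r, s, t, hm, hs, hr, h1⟩
    refine ⟨m, r, s, t * z, hm, hs, hr, ?_⟩
    convert h.mul_right z h1 using 1 <;> ring

theorem exists_mem_asymptoticSpectrum_le (h : IsStrassen le) {a : S} (ha : le 2 a) {Θ : ℝ}
    (hΘ : ∀ n N : ℕ, le n (a ^ N) → (n : ℝ) ≤ Θ ^ N) :
    ∃ φ ∈ asymptoticSpectrum S le, (φ a : ℝ) ≤ Θ := by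
  obtain ⟨φ, hφ, hle⟩ := (h.isStrassen_adjoinBound ha hΘ).exists_mem_asymptoticSpectrum
  obtain ⟨r₀, hr₀⟩ := exists_nat_gt Θ
  refine ⟨φ, fun x y hxy => hφ x y ⟨1, r₀, 1, 0, one_pos, one_pos, by simpa using hr₀,
    by simpa using hxy⟩, ?_⟩
  by_contra! hlt
  -- A fraction `q` strictly between `Θ` and `φ a` is one of the adjoined upper bounds on `a`, so `φ
  -- a ≤ q`.
  obtain ⟨q, hq1, hq2⟩ := exists_rat_btwn hlt
  have hΘ0 : (0 : ℝ) ≤ Θ := by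
    have : (2 : ℝ) ≤ Θ := by simpa using hΘ 2 1 (by simpa using ha)
    linarith
  have hq0 : 0 ≤ q := by exact_mod_cast hΘ0.trans hq1.le
  have hden : (0 : ℝ) < q.den := by exact_mod_cast q.den_pos
  have hqe : (q : ℝ) = q.num.toNat / q.den := by
    have h1 : ((q.num.toNat : ℤ) : ℝ) = q.num := by
      rw [Int.toNat_of_nonneg (Rat.num_nonneg.2 hq0)]
    rw [← Int.cast_natCast (R := ℝ), h1, ← Rat.cast_def]
  rw [hqe] at hq1 hq2
  rw [lt_div_iff₀' hden] at hq1
  rw [div_lt_iff₀' hden] at hq2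
  refine absurd (hle a q.num.toNat q.den q.den_pos ⟨1, _, _, 1, one_pos, q.den_pos, hq1, ?_⟩)
    (not_le.2 hq2)
  simp only [Nat.cast_one, one_mul]
  rw [add_comm]
  exact h.refl _

end IsStrassen

/-! ### Ranks of sums of positive semidefinite matrices -/

namespace Matrix

variable {n : Type*} [Fintype n]

theorem rank_add_le_rank_add_rank (A B : Matrix n n ℂ) : (A + B).rank ≤ A.rank + B.rank := by
  refine le_trans (Submodule.finrank_mono ?_)
    (Submodule.finrank_add_le_finrank_add_finrank A.mulVecLin.range B.mulVecLin.range)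
  rintro _ ⟨x, rfl⟩
  rw [mulVecLin_add, LinearMap.add_apply]
  exact Submodule.add_mem_sup ⟨x, rfl⟩ ⟨x, rfl⟩

theorem rank_sum_le {ι : Type*} (s : Finset ι) (A : ι → Matrix n n ℂ) :
    (∑ i ∈ s, A i).rank ≤ ∑ i ∈ s, (A i).rank := by
  classical
  induction s using Finset.induction_on with
  | empty => simp
  | insert i s hi ih =>
    rw [Finset.sum_insert hi, Finset.sum_insert hi]
    exact (rank_add_le_rank_add_rank _ _).trans (by omega)

open scoped ComplexOrder in
theorem IsHermitian.mulVec_eq_zero_of_mulVec_mulVec {A : Matrix n n ℂ} (hA : A.IsHermitian)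
    {x : n → ℂ} (hx : A *ᵥ (A *ᵥ x) = 0) : A *ᵥ x = 0 := by
  rw [mulVec_mulVec] at hx
  nth_rw 1 [← hA.eq] at hx
  exact (conjTranspose_mul_self_mulVec_eq_zero A x).1 hx

open scoped ComplexOrder in
theorem IsHermitian.rank_mul_self {A : Matrix n n ℂ} (hA : A.IsHermitian) :
    (A * A).rank = A.rank := by
  have := rank_conjTranspose_mul_self A
  rwa [hA.eq] at this

/-- A Hermitian `A` has the same range as `A * A`, and `(A + B) * A = A * A`. -/
theorem IsHermitian.range_le_of_mul_eq_zero {A B : Matrix n n ℂ} (hA : A.IsHermitian)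
    (hBA : B * A = 0) : A.mulVecLin.range ≤ (A + B).mulVecLin.range := by
  have h1 : (A * A).mulVecLin.range = A.mulVecLin.range := by
    refine Submodule.eq_of_le_of_finrank_eq ?_ hA.rank_mul_self
    rintro _ ⟨x, rfl⟩
    exact ⟨A *ᵥ x, by simp⟩
  rw [← h1]
  rintro _ ⟨x, rfl⟩
  exact ⟨A *ᵥ x, by simp [hBA]⟩

theorem IsHermitian.rank_add_rank_le {A B : Matrix n n ℂ} (hA : A.IsHermitian)
    (hB : B.IsHermitian) (hAB : A * B = 0) : A.rank + B.rank ≤ (A + B).rank := by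
  have hBA : B * A = 0 := by
    have := congrArg Matrix.conjTranspose hAB
    simpa [Matrix.conjTranspose_mul, hA.eq, hB.eq] using this
  have hinf : A.mulVecLin.range ⊓ B.mulVecLin.range = ⊥ := by
    rw [eq_bot_iff]
    rintro _ ⟨⟨x, rfl⟩, ⟨y, hy⟩⟩
    simp only [mulVecLin_apply] at hy ⊢
    refine hA.mulVec_eq_zero_of_mulVec_mulVec ?_
    rw [← hy, mulVec_mulVec, hAB, zero_mulVec]
  have h1 := Submodule.finrank_sup_add_finrank_inf_eq A.mulVecLin.range B.mulVecLin.range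
  rw [hinf, finrank_bot, add_zero] at h1
  refine h1.symm.le.trans (Submodule.finrank_mono (sup_le ?_ ?_))
  · exact hA.range_le_of_mul_eq_zero hBA
  · rw [add_comm A B]
    exact hB.range_le_of_mul_eq_zero hAB

theorem sum_rank_le_rank_sum {ι : Type*} (s : Finset ι) {A : ι → Matrix n n ℂ}
    (hA : ∀ i, (A i).IsHermitian) (hmul : ∀ i j, i ≠ j → A i * A j = 0) :
    ∑ i ∈ s, (A i).rank ≤ (∑ i ∈ s, A i).rank := by
  classical
  induction s using Finset.induction_on with
  | empty => simp
  | insert i s hi ih =>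
    rw [Finset.sum_insert hi, Finset.sum_insert hi]
    refine le_trans (Nat.add_le_add_left ih _) ((hA i).rank_add_rank_le ?_ ?_)
    · exact isSelfAdjoint_sum s fun j _ => hA j
    · rw [Finset.mul_sum]
      exact Finset.sum_eq_zero fun j hj => hmul _ _ fun h => hi (h ▸ hj)

theorem rank_le_rank_of_forall_mulVec_eq_zero {A B : Matrix n n ℂ}
    (h : ∀ x, B *ᵥ x = 0 → A *ᵥ x = 0) : A.rank ≤ B.rank := by
  have h1 := LinearMap.finrank_range_add_finrank_ker A.mulVecLin
  have h2 := LinearMap.finrank_range_add_finrank_ker B.mulVecLin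
  have h3 := Submodule.finrank_mono (s := B.mulVecLin.ker) (t := A.mulVecLin.ker) h
  unfold rank
  omega

open scoped ComplexOrder in
theorem PosSemidef.mulVec_eq_zero_of_sum_mulVec_eq_zero {ι : Type*} {s : Finset ι}
    {A : ι → Matrix n n ℂ} (hA : ∀ i, (A i).PosSemidef) {x : n → ℂ}
    (hx : (∑ i ∈ s, A i) *ᵥ x = 0) {i : ι} (hi : i ∈ s) : A i *ᵥ x = 0 := by
  rw [← (hA i).dotProduct_mulVec_zero_iff]
  refine (Finset.sum_eq_zero_iff_of_nonneg (f := fun i => star x ⬝ᵥ (A i *ᵥ x))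
    fun i _ => (hA i).dotProduct_mulVec_nonneg x).1 ?_ i hi
  rw [← dotProduct_sum, ← sum_mulVec, hx, dotProduct_zero]

end Matrix

/-! ### Properties of entanglement-assisted homomorphisms -/

open Matrix

namespace EntHom

open scoped ComplexOrder in
/-- The matrices of an entanglement-assisted homomorphism may have rows and columns indexed by any
finite type. -/
theorem of_fintype {V : Type u} {W : Type v} [Fintype W] {G : SimpleGraph V} {H : SimpleGraph W}
    {n : Type*} [Fintype n] (ρ : Matrix n n ℂ) (r : V → W → Matrix n n ℂ) (hρ : ρ.PosSemidef)
    (hρ0 : ρ ≠ 0) (hr : ∀ g h, (r g h).PosSemidef) (hsum : ∀ g, ∑ h, r g h = ρ)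
    (hmul : ∀ g g' h h', G.Adj g g' → ¬ H.Adj h h' → r g h * r g' h' = 0) : EntHom G H := by
  let e := (Fintype.equivFin n).symm
  refine ⟨Fintype.card n, ρ.submatrix e e, fun g h => (r g h).submatrix e e, hρ.submatrix e, ?_,
    fun g h => (hr g h).submatrix e, fun g => ?_, fun g g' h h' hg hh => ?_⟩
  · intro h0
    refine hρ0 ?_
    ext i j
    simpa using congrFun (congrFun h0 (e.symm i)) (e.symm j)
  · rw [← hsum g]
    ext i j
    simp [Matrix.sum_apply]
  · rw [submatrix_mul_equiv, hmul g g' h h' hg hh]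
    rfl

open scoped ComplexOrder in
theorem of_hom {V : Type u} {W : Type v} [Fintype W] {G : SimpleGraph V} {H : SimpleGraph W}
    (f : G →g H) : EntHom G H := by
  classical
  refine of_fintype (n := Unit) 1 (fun g h => if h = f g then 1 else 0) PosSemidef.one one_ne_zero
    (fun g h => ?_) (fun g => by simp) fun g g' h h' hg hh => ?_
  · split_ifs
    · exact PosSemidef.one
    · exact PosSemidef.zero
  · split_ifs with h1 h2
    · subst h1 h2
      exact absurd (f.map_adj hg) hh
    all_goals simp

open scoped ComplexOrder Kronecker in
-- Use the two states in parallel, summing `r g h ⊗ s h k` over the intermediate vertex. In each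
-- cross term `h, h'`, the second factors are orthogonal if `h, h'` are adjacent, the first factors
-- if not.
theorem trans {U : Type u} {V : Type v} {W : Type w} [Fintype V] [Fintype W] {G : SimpleGraph U}
    {H : SimpleGraph V} {K : SimpleGraph W} (h1 : EntHom G H) (h2 : EntHom H K) : EntHom G K := by
  obtain ⟨d, ρ, r, hρ, hρ0, hr, hsum, hmul⟩ := h1
  obtain ⟨d', σ, s, hσ, hσ0, hs, hsum', hmul'⟩ := h2
  have sum_kron : ∀ (A : V → Matrix (Fin d) (Fin d) ℂ) (B : Matrix (Fin d') (Fin d') ℂ),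
      ∑ h, A h ⊗ₖ B = (∑ h, A h) ⊗ₖ B := by
    intro A B
    ext i j
    simp [Matrix.sum_apply, Finset.sum_mul]
  have kron_sum : ∀ (A : Matrix (Fin d) (Fin d) ℂ) (B : W → Matrix (Fin d') (Fin d') ℂ),
      ∑ k, A ⊗ₖ B k = A ⊗ₖ (∑ k, B k) := by
    intro A B
    ext i j
    simp [Matrix.sum_apply, Finset.mul_sum]
  refine of_fintype (ρ ⊗ₖ σ) (fun g k => ∑ h, r g h ⊗ₖ s h k) (hρ.kronecker hσ) ?_ (fun g k => ?_)
    (fun g => ?_) fun g g' k k' hg hk => ?_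
  · obtain ⟨i, j, hij⟩ : ∃ i j, ρ i j ≠ 0 := by
      by_contra! h
      exact hρ0 (Matrix.ext h)
    obtain ⟨i', j', hij'⟩ : ∃ i j, σ i j ≠ 0 := by
      by_contra! h
      exact hσ0 (Matrix.ext h)
    intro h0
    have := congrFun (congrFun h0 (i, i')) (j, j')
    simp [hij, hij'] at this
  · exact posSemidef_sum _ fun h _ => (hr g h).kronecker (hs h k)
  · rw [Finset.sum_comm]
    simp_rw [kron_sum, hsum', sum_kron, hsum]
  · rw [Finset.sum_mul_sum]
    refine Finset.sum_eq_zero fun h _ => Finset.sum_eq_zero fun h' _ => ?_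
    rw [← mul_kronecker_mul]
    by_cases hh : H.Adj h h'
    · rw [hmul' h h' k k' hh hk, kronecker_zero]
    · rw [hmul g g' h h' hg hh, zero_kronecker]

open scoped ComplexOrder in
-- Double count the ranks of `r g h`. For fixed `g` they sum to at least `rank ρ`. For fixed `h` the
-- matrices are pairwise orthogonal and vanish on the kernel of `ρ`, so their ranks sum to at most
-- `rank ρ`.
theorem card_le_card {V : Type u} {W : Type v} [Fintype V] [Fintype W]
    (h : EntHom (⊤ : SimpleGraph V) (⊤ : SimpleGraph W)) : Fintype.card V ≤ Fintype.card W := by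
  obtain ⟨d, ρ, r, hρ, hρ0, hr, hsum, hmul⟩ := h
  have h1 : ∀ g, ρ.rank ≤ ∑ h, (r g h).rank := fun g => hsum g ▸ rank_sum_le _ _
  have h2 : ∀ h, ∑ g, (r g h).rank ≤ ρ.rank := by
    intro h
    refine (sum_rank_le_rank_sum Finset.univ (A := fun g => r g h) (fun g => (hr g h).isHermitian)
      fun g g' hg => hmul g g' h h hg (SimpleGraph.irrefl _)).trans
      (rank_le_rank_of_forall_mulVec_eq_zero fun x hx => ?_)
    rw [sum_mulVec]
    refine Finset.sum_eq_zero fun g _ => ?_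
    rw [← hsum g] at hx
    exact PosSemidef.mulVec_eq_zero_of_sum_mulVec_eq_zero (hr g) hx (Finset.mem_univ h)
  have h3 : Fintype.card V * ρ.rank ≤ Fintype.card W * ρ.rank := by
    calc Fintype.card V * ρ.rank = ∑ _g : V, ρ.rank := by simp
      _ ≤ ∑ g, ∑ h, (r g h).rank := Finset.sum_le_sum fun g _ => h1 g
      _ = ∑ h, ∑ g, (r g h).rank := Finset.sum_comm
      _ ≤ ∑ _h : W, ρ.rank := Finset.sum_le_sum fun h _ => h2 h
      _ = Fintype.card W * ρ.rank := by simp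
  refine Nat.le_of_mul_le_mul_right h3 (Nat.pos_of_ne_zero fun h0 => hρ0 ?_)
  rw [rank, Submodule.finrank_eq_zero, LinearMap.range_eq_bot] at h0
  ext i j
  simpa using congrFun (LinearMap.congr_fun h0 (Pi.single j 1)) i

end EntHom

namespace EntCohom

theorem of_map {V : Type u} {W : Type v} [Fintype W] {G : SimpleGraph V} {H : SimpleGraph W}
    (f : V → W) (hf : ∀ x y, x ≠ y → ¬ G.Adj x y → f x ≠ f y ∧ ¬ H.Adj (f x) (f y)) :
    EntCohom G H :=
  EntHom.of_hom ⟨f, fun {x y} h => by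
    rw [SimpleGraph.compl_adj] at h ⊢
    exact hf x y h.1 h.2⟩

open scoped ComplexOrder in
theorem sum_right {V V' : Type u} {W : Type v} [Fintype V'] [Fintype W] {G : SimpleGraph V}
    {G' : SimpleGraph V'} (h : EntCohom G G') (H : SimpleGraph W) :
    EntCohom (G ⊕g H) (G' ⊕g H) := by
  classical
  obtain ⟨d, ρ, r, hρ, hρ0, hr, hsum, hmul⟩ := h
  refine ⟨d, ρ, fun x y => Sum.elim (fun g => Sum.elim (fun g' => r g g') (fun _ => 0) y)
    (fun k => Sum.elim (fun _ => 0) (fun k' => if k' = k then ρ else 0) y) x, hρ, hρ0, ?_, ?_, ?_⟩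
  · rintro (g | k) (g' | k')
    · exact hr g g'
    · exact PosSemidef.zero
    · exact PosSemidef.zero
    · simp only [Sum.elim_inr]
      split_ifs
      · exact hρ
      · exact PosSemidef.zero
  · rintro (g | k) <;> simp [hsum]
  · rintro (g | k) (g₂ | k₂) (g' | k') (g₂' | k₂') hadj hnadj <;>
      simp only [Sum.elim_inl, Sum.elim_inr, mul_zero, zero_mul]
    · apply hmul
      · simpa using hadj
      · simpa using hnadj
    · simp at hnadj
    · simp at hnadj
    · split_ifs with h1 h2
      · subst h1 h2
        exact absurd (by simpa using hadj) hnadj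
      all_goals simp

open scoped ComplexOrder in
theorem strongProd_right {V V' : Type u} {W : Type v} [Fintype V'] [Fintype W] {G : SimpleGraph V}
    {G' : SimpleGraph V'} (h : EntCohom G G') (H : SimpleGraph W) :
    EntCohom (strongProd G H) (strongProd G' H) := by
  classical
  obtain ⟨d, ρ, r, hρ, hρ0, hr, hsum, hmul⟩ := h
  -- The `H`-coordinate is copied unchanged. Where both copies match, they are equal or adjacent in
  -- `H`, so the condition reduces to the one on `G` and `G'`.
  refine ⟨d, ρ, fun x y => if y.2 = x.2 then r x.1 y.1 else 0, hρ, hρ0, ?_, ?_, ?_⟩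
  · intro x y
    dsimp only
    split_ifs
    · exact hr _ _
    · exact PosSemidef.zero
  · rintro ⟨g, k⟩
    rw [Fintype.sum_prod_type]
    simpa using hsum g
  · rintro ⟨g, k⟩ ⟨g₂, k₂⟩ ⟨g', k'⟩ ⟨g₂', k₂'⟩ hadj hnadj
    dsimp only
    split_ifs with h1 h2
    · subst h1 h2
      rw [SimpleGraph.compl_adj] at hadj hnadj
      simp only [strongProd, ne_eq, Prod.mk.injEq] at hadj hnadj
      apply hmul
      · rw [SimpleGraph.compl_adj]
        by_contra hc
        tauto
      · rw [SimpleGraph.compl_adj]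
        intro hc
        tauto
    all_goals simp

end EntCohom

/-! ### The cohomomorphism preorder on graphs is a Strassen preorder -/

namespace GraphClass

theorem mk_bot_eq {V W : Type u} [Fintype V] [Fintype W] (e : V ≃ W) :
    mk (⊥ : SimpleGraph V) = mk (⊥ : SimpleGraph W) :=
  mk_eq_mk.2 ⟨⟨e, by simp⟩⟩

theorem natCast_eq_edgeless (n : ℕ) : (n : GraphClass.{u}) = edgeless n := by
  induction n with
  | zero =>
    rw [Nat.cast_zero]
    exact mk_bot_eq (Equiv.equivOfIsEmpty _ _)
  | succ n ih =>
    rw [Nat.cast_succ, ih]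
    have h1 : ((⊥ : SimpleGraph (ULift.{u} (Fin n))) ⊕g (⊥ : SimpleGraph PUnit.{u + 1})) = ⊥ := by
      ext (x | x) (y | y) <;> simp
    refine (mk_add_mk (⊥ : SimpleGraph (ULift.{u} (Fin n))) (⊥ : SimpleGraph PUnit.{u + 1})).trans ?_
    rw [h1]
    refine mk_bot_eq (Fintype.equivOfCardEq ?_)
    simp

theorem entLE_natCast_card {V : Type u} [Fintype V] (G : SimpleGraph V) :
    EntLE (mk G) (Fintype.card V : ℕ) := by
  rw [natCast_eq_edgeless, edgeless, entLE_mk]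
  refine EntCohom.of_map (fun x => ULift.up (Fintype.equivFin V x)) fun x y hxy _ => ?_
  simpa using hxy

theorem natCast_entLE_mk {V : Type u} [Fintype V] {G : SimpleGraph V} {n : ℕ} (f : Fin n → V)
    (hf : ∀ i j, i ≠ j → f i ≠ f j ∧ ¬ G.Adj (f i) (f j)) : EntLE n (mk G) := by
  rw [natCast_eq_edgeless, edgeless, entLE_mk]
  exact EntCohom.of_map (fun i => f i.down) fun i j hij _ =>
    hf _ _ fun h => hij (ULift.ext _ _ h)

theorem isStrassen_entLE : IsStrassen EntLE.{u} where
  refl x := by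
    induction x using ind with | _ V G
    exact EntCohom.of_map id fun _ _ h h' => ⟨h, h'⟩
  trans {x y z} hxy hyz := by
    induction x using ind with | _ U G
    induction y using ind with | _ V H
    induction z using ind with | _ W K
    exact EntHom.trans hxy hyz
  add_right {x y} z hxy := by
    induction x using ind with | _ U G
    induction y using ind with | _ V H
    induction z using ind with | _ W K
    exact EntCohom.sum_right hxy K
  mul_right {x y} z hxy := by
    induction x using ind with | _ U G
    induction y using ind with | _ V H
    induction z using ind with | _ W K
    exact EntCohom.strongProd_right hxy K
  zero_le x := by
    induction x using ind with | _ V G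
    simpa using natCast_entLE_mk (G := G) (n := 0) Fin.elim0 fun i => i.elim0
  zero_or_one_le x := by
    induction x using ind with | _ V G
    rcases isEmpty_or_nonempty V with hV | ⟨⟨v⟩⟩
    · left
      exact mk_eq_mk.2 ⟨⟨Equiv.equivOfIsEmpty _ _, fun {a} => isEmptyElim a⟩⟩
    · right
      simpa using natCast_entLE_mk (G := G) (n := 1) (fun _ => v)
        fun i j hij => absurd (Subsingleton.elim i j) hij
  exists_natCast_ge x := by
    induction x using ind with | _ V G
    exact ⟨_, entLE_natCast_card G⟩
  natCast_le {n m} h := by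
    rw [natCast_eq_edgeless, natCast_eq_edgeless, edgeless, edgeless, entLE_mk, EntCohom,
      compl_bot, compl_bot] at h
    simpa using h.card_le_card

/-- Either `G` is complete and collapses to a point, or two distinct nonadjacent vertices give `2 ≤
a`, as the duality argument needs. -/
theorem entLE_one_or_two_entLE (a : GraphClass.{u}) : EntLE a 1 ∨ EntLE 2 a := by
  induction a using ind with | _ V G
  by_cases hG : ∃ x y, x ≠ y ∧ ¬ G.Adj x y
  · right
    obtain ⟨x, y, hxy, hadj⟩ := hG
    refine (Nat.cast_ofNat (R := GraphClass.{u}) (n := 2)) ▸ natCast_entLE_mk ![x, y] ?_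
    have h' : ¬ G.Adj y x := fun h => hadj h.symm
    intro i j hij
    fin_cases i <;> fin_cases j <;> simp_all [hxy.symm]
  · left
    push Not at hG
    exact EntCohom.of_map (H := (⊥ : SimpleGraph PUnit.{u + 1})) (fun _ => PUnit.unit)
      fun x y hxy hadj => absurd (hG x y hxy) hadj

/-! ### The entanglement-assisted Shannon capacity -/

theorem isGreatest_entIndepNum (a : GraphClass.{u}) :
    IsGreatest {n : ℕ | EntLE (edgeless n) a} (entIndepNum a) := by
  obtain ⟨k, hk⟩ := isStrassen_entLE.exists_natCast_ge a
  have hbdd : BddAbove {n : ℕ | EntLE (edgeless n) a} := ⟨k, fun n hn => by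
    rw [Set.mem_ofPred_eq, ← natCast_eq_edgeless] at hn
    exact isStrassen_entLE.natCast_le (isStrassen_entLE.trans hn hk)⟩
  refine ⟨Nat.sSup_mem ⟨0, ?_⟩ hbdd, fun n hn => le_csSup hbdd hn⟩
  rw [Set.mem_ofPred_eq, ← natCast_eq_edgeless]
  simpa using isStrassen_entLE.zero_le a

theorem entIndepNum_entLE (a : GraphClass.{u}) : EntLE (entIndepNum a : ℕ) a := by
  rw [natCast_eq_edgeless]
  exact (isGreatest_entIndepNum a).1

theorem le_entIndepNum {a : GraphClass.{u}} {n : ℕ} (h : EntLE n a) : n ≤ entIndepNum a := by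
  rw [natCast_eq_edgeless] at h
  exact (isGreatest_entIndepNum a).2 h

theorem entIndepNum_natCast (n : ℕ) : entIndepNum (n : GraphClass.{u}) = n :=
  le_antisymm (isStrassen_entLE.natCast_le (entIndepNum_entLE _))
    (le_entIndepNum (isStrassen_entLE.refl _))

theorem entIndepNum_mul_le (a b : GraphClass.{u}) :
    entIndepNum a * entIndepNum b ≤ entIndepNum (a * b) := by
  refine le_entIndepNum ?_
  rw [Nat.cast_mul]
  exact isStrassen_entLE.mul (entIndepNum_entLE a) (entIndepNum_entLE b)

/-- Fekete's lemma for `-log u`: the limit is also an infimum, which yields `u N ≤ Θ ^ N` for every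
`N`. -/
theorem exists_tendsto_rpow_inv {u : ℕ → ℕ} (hpos : ∀ n, 0 < u n)
    (hmul : ∀ m n, u m * u n ≤ u (m + n)) {k : ℕ} (hk : ∀ n, u n ≤ k ^ n) :
    ∃ Θ : ℝ, Tendsto (fun N : ℕ => (u N : ℝ) ^ ((1 : ℝ) / (N : ℝ))) atTop (𝓝 Θ) ∧
      0 ≤ Θ ∧ ∀ N, (u N : ℝ) ≤ Θ ^ N := by
  have hpos' : ∀ n, (0 : ℝ) < u n := fun n => by exact_mod_cast hpos n
  have hsub : Subadditive fun n => -Real.log (u n) := by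
    intro m n
    have h1 : Real.log (u m * u n) ≤ Real.log (u (m + n)) :=
      Real.log_le_log (mul_pos (hpos' m) (hpos' n)) (by exact_mod_cast hmul m n)
    rw [Real.log_mul (hpos' m).ne' (hpos' n).ne'] at h1
    linarith
  have hbdd : BddBelow (Set.range fun n : ℕ => -Real.log (u n) / n) := by
    refine ⟨-Real.log k, ?_⟩
    rintro _ ⟨n, rfl⟩
    rcases Nat.eq_zero_or_pos n with rfl | hn
    · simpa using Real.log_natCast_nonneg k
    · have hn' : (0 : ℝ) < n := by exact_mod_cast hn
      have h1 : Real.log (u n) ≤ Real.log ((k : ℝ) ^ n) :=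
        Real.log_le_log (hpos' n) (by exact_mod_cast hk n)
      rw [Real.log_pow] at h1
      dsimp only
      rw [le_div_iff₀ hn']
      linarith
  refine ⟨Real.exp (-hsub.lim), ?_, (Real.exp_pos _).le, fun N => ?_⟩
  · refine ((Real.continuous_exp.tendsto _).comp (hsub.tendsto_lim hbdd).neg).congr fun N => ?_
    rw [Function.comp_apply, Real.rpow_def_of_pos (hpos' N)]
    congr 1
    ring
  · rcases Nat.eq_zero_or_pos N with rfl | hN
    · simpa using hk 0
    · have hN' : (0 : ℝ) < N := by exact_mod_cast hN
      have h1 := hsub.lim_le_div hbdd hN.ne'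
      rw [le_div_iff₀ hN'] at h1
      rw [← Real.exp_nat_mul, ← Real.log_le_iff_le_exp (hpos' N)]
      linarith

theorem entIndepNum_pow_pos {a : GraphClass.{u}} (ha : a ≠ 0) (N : ℕ) :
    0 < entIndepNum (a ^ N) := by
  refine le_entIndepNum ?_
  simpa using isStrassen_entLE.pow (isStrassen_entLE.one_le ha) N

theorem exists_tendsto_entIndepNum (a : GraphClass.{u}) :
    ∃ Θ : ℝ, Tendsto (fun N : ℕ => ((entIndepNum (a ^ N) : ℕ) : ℝ) ^ ((1 : ℝ) / (N : ℝ)))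
      atTop (𝓝 Θ) ∧ 0 ≤ Θ ∧ ∀ N, ((entIndepNum (a ^ N) : ℕ) : ℝ) ≤ Θ ^ N := by
  -- The zero class is separate because the logarithms in Fekete's lemma need positive terms; only
  -- `N = 0` contributes a nonzero value there.
  by_cases ha : a = 0
  · subst ha
    have h0 : ∀ N, N ≠ 0 → entIndepNum ((0 : GraphClass.{u}) ^ N) = 0 := fun N hN => by
      rw [zero_pow hN]
      simpa using entIndepNum_natCast.{u} 0
    refine ⟨0, tendsto_const_nhds.congr' ?_, le_rfl, fun N => ?_⟩
    · filter_upwards [eventually_ne_atTop 0] with N hN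
      rw [h0 N hN, Nat.cast_zero, Real.zero_rpow]
      simpa using hN
    · rcases eq_or_ne N 0 with rfl | hN
      · simpa using (entIndepNum_natCast.{u} 1).le
      · rw [h0 N hN, zero_pow hN, Nat.cast_zero]
  · obtain ⟨k, hk⟩ := isStrassen_entLE.exists_natCast_ge a
    refine exists_tendsto_rpow_inv (k := k) (entIndepNum_pow_pos ha) (fun m n => ?_) fun n => ?_
    · rw [pow_add]
      exact entIndepNum_mul_le _ _
    · refine isStrassen_entLE.natCast_le (isStrassen_entLE.trans (entIndepNum_entLE _) ?_)
      rw [Nat.cast_pow]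
      exact isStrassen_entLE.pow hk n

theorem tendsto_entShannonCapacity (a : GraphClass.{u}) :
    Tendsto (fun N : ℕ => ((entIndepNum (a ^ N) : ℕ) : ℝ) ^ ((1 : ℝ) / (N : ℝ))) atTop
      (𝓝 (entShannonCapacity a)) := by
  obtain ⟨Θ, hΘ, -⟩ := exists_tendsto_entIndepNum a
  rwa [entShannonCapacity, hΘ.limUnder_eq]

theorem entShannonCapacity_nonneg (a : GraphClass.{u}) : 0 ≤ entShannonCapacity a := by
  obtain ⟨Θ, hΘ, h, -⟩ := exists_tendsto_entIndepNum a
  rwa [entShannonCapacity, hΘ.limUnder_eq]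

theorem entIndepNum_le_entShannonCapacity_pow (a : GraphClass.{u}) (N : ℕ) :
    ((entIndepNum (a ^ N) : ℕ) : ℝ) ≤ entShannonCapacity a ^ N := by
  obtain ⟨Θ, hΘ, -, h⟩ := exists_tendsto_entIndepNum a
  rw [entShannonCapacity, hΘ.limUnder_eq]
  exact h N

theorem entShannonCapacity_le {φ : GraphClass.{u} →+* ℝ≥0}
    (hφ : φ ∈ asymptoticSpectrum GraphClass.{u} EntLE) (a : GraphClass.{u}) :
    entShannonCapacity a ≤ φ a := by
  refine le_of_tendsto (tendsto_entShannonCapacity a) ?_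
  filter_upwards [eventually_ne_atTop 0] with N hN
  have h1 := hφ _ _ (entIndepNum_entLE (a ^ N))
  rw [map_natCast, map_pow] at h1
  have h2 : ((entIndepNum (a ^ N) : ℕ) : ℝ) ≤ (φ a : ℝ) ^ N := by exact_mod_cast h1
  rw [one_div]
  calc _ ≤ ((φ a : ℝ) ^ N) ^ ((N : ℝ)⁻¹) :=
        Real.rpow_le_rpow (Nat.cast_nonneg _) h2 (by positivity)
    _ = φ a := Real.pow_rpow_inv_natCast (φ a).2 hN

theorem exists_le_entShannonCapacity (a : GraphClass.{u}) :
    ∃ φ ∈ asymptoticSpectrum GraphClass.{u} EntLE, (φ a : ℝ) ≤ entShannonCapacity a := by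
  rcases entLE_one_or_two_entLE a with ha | ha
  -- Any spectral point works here: for `a ≠ 0`, `φ a ≤ 1 ≤ α⁎(a) ≤ Θ⁎(a)`.
  · obtain ⟨φ, hφ, -⟩ := isStrassen_entLE.{u}.exists_mem_asymptoticSpectrum
    refine ⟨φ, hφ, ?_⟩
    by_cases h0 : a = 0
    · simpa [h0] using entShannonCapacity_nonneg 0
    · have h1 : φ a ≤ 1 := by simpa using hφ _ _ ha
      have h2 : (1 : ℝ) ≤ (entIndepNum (a ^ 1) : ℕ) := by exact_mod_cast entIndepNum_pow_pos h0 1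
      have h3 := entIndepNum_le_entShannonCapacity_pow a 1
      rw [pow_one (entShannonCapacity a)] at h3
      exact (show (φ a : ℝ) ≤ 1 by exact_mod_cast h1).trans (h2.trans h3)
  · refine isStrassen_entLE.exists_mem_asymptoticSpectrum_le ha fun n N hn => ?_
    refine le_trans ?_ (entIndepNum_le_entShannonCapacity_pow a N)
    exact_mod_cast le_entIndepNum hn

end GraphClass

theorem mainTheorem3 {V : Type u} [Fintype V] (G : SimpleGraph V) :
    (∀ N : ℕ, IsGreatest {n : ℕ | GraphClass.EntLE (GraphClass.edgeless n) (GraphClass.mk G ^ N)}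
      (GraphClass.entIndepNum (GraphClass.mk G ^ N))) ∧
    Tendsto (fun N : ℕ => ((GraphClass.entIndepNum (GraphClass.mk G ^ N) : ℕ) : ℝ)
      ^ ((1 : ℝ) / (N : ℝ))) atTop (𝓝 (GraphClass.entShannonCapacity (GraphClass.mk G))) ∧
    IsLeast ((fun φ : GraphClass.{u} →+* ℝ≥0 => (φ (GraphClass.mk G) : ℝ)) ''
      asymptoticSpectrum GraphClass.{u} GraphClass.EntLE)
      (GraphClass.entShannonCapacity (GraphClass.mk G)) := by
  refine ⟨fun N => GraphClass.isGreatest_entIndepNum _, GraphClass.tendsto_entShannonCapacity _,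
    ?_, ?_⟩
  · obtain ⟨φ, hφ, hle⟩ := GraphClass.exists_le_entShannonCapacity (GraphClass.mk G)
    exact ⟨φ, hφ, hle.antisymm (GraphClass.entShannonCapacity_le hφ _)⟩
  · rintro _ ⟨φ, hφ, rfl⟩
    exact GraphClass.entShannonCapacity_le hφ _
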